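/- Let $V$ be a real reflexive Banach space with dual $V^*$ and duality pairing $\langle\cdot,\cdot\rangle$, let $|\cdot|$ be a lower semicontinuous seminorm on $V$ with kernel $Y=\{y\in V: |y|=0\}$, and let $A:V\to V^*$ be a linear operator that is semicoercive, i.e. there is $c_0>0$ with $\langle Av,v\rangle\ge c_0|v|^2$ for all $v\in V$. Let $g\in V^*$, let $K\subseteq V$ be closed and convex with $0\in K$, and let $\varphi:K\times K\to\mathbb R$ be a bifunction such that $\varphi(u,u)=0$ and $\varphi(u,\cdot)$ is convex on $K$ for every $u\in K$. Suppose that: - $\varphi$ is pseudomonotone: if $u_n,u\in K$, $u_n\rightharpoonup u$ weakly in $V$ and $\liminf_{n\to\infty}\varphi(u_n,u)\ge 0$, then $\limsup_{n\to\infty}\varphi(u_n,v)\le\varphi(u,v)$ for all $v\in K$; - for every $v\in K$, $\varphi(\cdot,v)$ is upper semicontinuous on the intersection of $K$ with any finite-dimensional subspace of $V$; - there is a constant $c>0$ with $\varphi(v,0)\le c\|v\|$ for all $v\in K$; - (A1$^s$) every sequence $(v_n)$ in $V$ with $|v_n|\to0$, $v_n\rightharpoonup v$ and $\|v_n\|\ge\eta$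 for some $\eta>0$ has a subsequence converging to $v$ in the norm of $V$; - either (i) $Y\cap K$ is bounded, or (iii) with the same constant $c$, $\langle g,y\rangle<-c$ for all $y\in Y\cap K$ with $\|y\|=1$. Then the problem $VI(A,\varphi,g,K)$ has a solution: there is $u\in K$ with $$\langle Au,v-u\rangle+\varphi(u,v)\ge\langle g,v-u\rangle\qquad\text{for all } v\in K.$$ -/

import Mathlib

open Filter Topology

namespace SemicoerciveVI

variable {V : Type*} [NormedAddCommGroup V] [NormedSpace ℝ V]

/-- The canonical embedding of `V` into its bidual is onto. -/
def IsReflexive (V : Type*) [NormedAddCommGroup V] [NormedSpace ℝ V] : Prop :=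
  Function.Surjective (NormedSpace.inclusionInDoubleDual ℝ V)

/-- Weak convergence `uₙ ⇀ u` of a sequence in `V`. -/
def WeaklyConverges (u : ℕ → V) (x : V) : Prop :=
  Tendsto (fun n => toWeakSpace ℝ V (u n)) atTop (𝓝 (toWeakSpace ℝ V x))

/-- `A : V → V*` is semicoercive with respect to the seminorm `|·| = p`:
`p` is lower semicontinuous and `⟨A v, v⟩ ≥ c₀ |v|²` for some `c₀ > 0`. -/
def IsSemicoercive (A : V →ₗ[ℝ] StrongDual ℝ V) (p : Seminorm ℝ V) : Prop :=
  LowerSemicontinuous (fun v => p v) ∧ ∃ c₀ : ℝ, 0 < c₀ ∧ ∀ v : V, c₀ * p v ^ 2 ≤ A v v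

/-- The kernel `Y` of the seminorm `p`. -/
def seminormKernel (p : Seminorm ℝ V) : Set V := {y | p y = 0}

/-- Pseudomonotonicity of the bifunction `φ` on `K × K`; the lower and upper limits are taken in
the extended reals. -/
def IsPseudomonotoneBifunction (K : Set V) (φ : V → V → ℝ) : Prop :=
  ∀ (u : ℕ → V) (x : V), (∀ n, u n ∈ K) → x ∈ K → WeaklyConverges u x →
    0 ≤ liminf (fun n => (φ (u n) x : EReal)) atTop →
    ∀ v ∈ K, limsup (fun n => (φ (u n) v : EReal)) atTop ≤ (φ x v : EReal)

/-- For each `v ∈ K`, the function `φ(·, v)` is upper semicontinuous on the intersection of `K`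
with any finite-dimensional subspace. -/
def IsFiniteDimUSC (K : Set V) (φ : V → V → ℝ) : Prop :=
  ∀ v ∈ K, ∀ W : Submodule ℝ V, FiniteDimensional ℝ W →
    UpperSemicontinuousOn (fun u => φ u v) (K ∩ (W : Set V))

/-- Every sequence with `|vₙ| → 0`, `vₙ ⇀ v` and `‖vₙ‖ ≥ η > 0` has a subsequence that converges
to `v` in norm. -/
def SeminormCompactness (p : Seminorm ℝ V) : Prop :=
  ∀ (w : ℕ → V) (v : V), Tendsto (fun n => p (w n)) atTop (𝓝 0) → WeaklyConverges w v →
    (∃ η : ℝ, 0 < η ∧ ∀ n, η ≤ ‖w n‖) →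
    ∃ k : ℕ → ℕ, StrictMono k ∧ Tendsto (fun n => w (k n)) atTop (𝓝 v)

/-- `u` solves `VI(A, φ, g, K)`. -/
def IsSolution (A : V →ₗ[ℝ] StrongDual ℝ V) (φ : V → V → ℝ) (g : StrongDual ℝ V) (K : Set V)
    (u : V) : Prop :=
  u ∈ K ∧ ∀ v ∈ K, g (v - u) ≤ A u (v - u) + φ u v

end SemicoerciveVI

/-!
The inequality asks for `u ∈ K` with `ψ u v ≥ 0` for all `v ∈ K`, where
`ψ u v = ⟨A u, v - u⟩ + φ u v - ⟨g, v - u⟩` vanishes on the diagonal and is convex in `v`.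

*Bounded `K`.* For finitely many test points `v`, a point `u` with `ψ u v ≥ 0` exists by the
Knaster–Kuratowski–Mazurkiewicz lemma, applied on the simplex which they span
(`exists_forall_mem_finset_nonneg`). The sets of such points are nonempty and directed, so by weak
compactness their weak closures have a common point `u`. Given `v`, the point `u` lies in the weak
closure of the points good for both `u` and `v`, hence is the weak limit of a *sequence* of them
(`IsReflexive.exists_seq_weaklyConverges`), and pseudomonotonicity gives `ψ u v ≥ 0`. The
contribution of `A` passes to the limit because a positive semidefinite operator is continuous and
`v ↦ ⟨A v, v⟩` is weakly lower semicontinuous (`nonneg_of_weaklyConverges`).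

*Unbounded `K`.* Solve on `K ∩ closedBall 0 (n + 1)`. A solution in the open ball solves the full
problem (`IsSolution.of_truncated`). If all solutions `u n` lie on the spheres, testing with `v = 0`
gives `c₀ |u n|² ≤ c ‖u n‖ + ⟨g, u n⟩`, so the normalized solutions have seminorms tending to `0`
and, by the compactness assumption, subconverge in norm to a unit vector `w` of the kernel `Y` whose
half-line lies in `K` and which satisfies `⟨g, w⟩ ≥ -c` (`exists_recession_direction`). Each of the
two alternatives excludes such a `w`.

The KKM lemma is derived from Brouwer's theorem, and the latter from the absence of a `C¹`
retraction of a ball onto its sphere, proved by the volume argument of Milnor and Rogers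
(`no_contDiff_retraction`). The passage from weak closures to sequences rests on the compactness of
the dual ball, which yields a countable subset, and on countably many functionals that are
separating on the closed span of that subset.
-/

namespace SemicoerciveVI

open Metric Set MeasureTheory

/-! ### Non-existence of a `C¹` retraction of the ball onto the sphere -/

section NoRetraction

variable {E : Type*} [NormedAddCommGroup E]

/-- Each `t ↦ det (1 + t M)` is a polynomial of degree at most `dim E`, so its value at `t = 1` is a
combination of its values at any `dim E + 1` nodes, with weights that do not depend on `M`. -/
lemma exists_det_interpolation [NormedSpace ℝ E] [FiniteDimensional ℝ E] {δ : ℝ} (hδ : 0 < δ) :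
    ∃ (s : Finset ℝ) (w : ℝ → ℝ), (∀ t ∈ s, 0 < t ∧ t < δ) ∧
      ∀ M : E →L[ℝ] E, (1 + M).det = ∑ t ∈ s, w t * (1 + t • M).det := by
  classical
  obtain ⟨s, hs, hcard⟩ := (Ioo_infinite hδ).exists_subset_card_eq (Module.finrank ℝ E + 1)
  refine ⟨s, fun t => (Lagrange.basis s id t).eval 1, fun t ht => hs ht, fun M => ?_⟩
  let b := Module.finBasis ℝ E
  let B := LinearMap.toMatrix b b (M : E →ₗ[ℝ] E)
  let q : Polynomial ℝ :=
    ((Polynomial.X : Polynomial ℝ) • B.map Polynomial.C + (1 : Matrix _ _ ℝ).map Polynomial.C).det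
  have heval (t : ℝ) : (1 + t • M).det = q.eval t := by
    have h1 : (1 + t • M).det = (1 + t • B).det := by
      rw [ContinuousLinearMap.det, ← LinearMap.det_toMatrix b]
      congr 1
      simp [B, LinearMap.toMatrix_one]
    rw [h1, ← Polynomial.coe_evalRingHom, RingHom.map_det]
    congr 1
    ext i j
    simp only [Matrix.add_apply, Matrix.smul_apply, RingHom.mapMatrix_apply, Matrix.map_apply,
      smul_eq_mul, Polynomial.coe_evalRingHom, Polynomial.eval_add, Polynomial.eval_mul,
      Polynomial.eval_X, Polynomial.eval_C]
    ring
  have hdeg : q.degree < (s.card : WithBot ℕ) := by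
    refine lt_of_le_of_lt Polynomial.degree_le_natDegree ?_
    have := Polynomial.natDegree_det_X_add_C_le B 1
    rw [Fintype.card_fin] at this
    rw [hcard]
    exact_mod_cast Nat.lt_succ_of_le this
  have h1 := heval 1
  rw [one_smul] at h1
  rw [h1, Lagrange.eq_interpolate (v := id) (Function.injective_id.injOn) hdeg,
    Lagrange.interpolate_apply, Polynomial.eval_finsetSum]
  refine Finset.sum_congr rfl fun t _ => ?_
  rw [Polynomial.eval_mul, Polynomial.eval_C, heval, id, mul_comm]

lemma det_one_add_smul_pos [NormedSpace ℝ E] [FiniteDimensional ℝ E] {M : E →L[ℝ] E} {t : ℝ}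
    (ht : 0 ≤ t) (hM : t * ‖M‖ < 1) : 0 < (1 + t • M).det := by
  have hne : ∀ s ∈ Icc 0 t, (1 + s • M).det ≠ 0 := by
    intro s hs h0
    have hbot : LinearMap.ker (1 + s • M : E →L[ℝ] E).toLinearMap ≠ ⊥ := by
      intro hb
      have := LinearMap.bot_lt_ker_of_det_eq_zero (f := (1 + s • M : E →L[ℝ] E).toLinearMap) h0
      exact this.ne' hb
    obtain ⟨x, hx, hx0⟩ := (Submodule.ne_bot_iff _).1 hbot
    have hx' : x = -(s • M x) := by
      have : x + s • M x = 0 := by simpa using hx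
      exact eq_neg_of_add_eq_zero_left this
    have h1 : ‖x‖ ≤ (t * ‖M‖) * ‖x‖ := by
      calc ‖x‖ = s * ‖M x‖ := by
            conv_lhs => rw [hx']
            rw [norm_neg, norm_smul, Real.norm_of_nonneg hs.1]
        _ ≤ t * (‖M‖ * ‖x‖) := by
            gcongr
            · exact hs.2
            · exact M.le_opNorm x
        _ = _ := by ring
    have h2 : 0 < ‖x‖ := norm_pos_iff.2 hx0
    nlinarith
  have hcont : ContinuousOn (fun s : ℝ => (1 + s • M).det) (Icc 0 t) := by
    refine (ContinuousLinearMap.continuous_det.comp ?_).continuousOn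
    fun_prop
  by_contra hle
  have h01 : (1 + (0 : ℝ) • M).det = 1 := by
    simp [ContinuousLinearMap.det]
  have := intermediate_value_Icc' ht hcont
  obtain ⟨s, hs, hs0⟩ := this (show (0 : ℝ) ∈ Icc _ _ from ⟨not_lt.1 hle, h01.symm ▸ zero_le_one⟩)
  exact hne s hs hs0

variable [InnerProductSpace ℝ E] [FiniteDimensional ℝ E]

/-- For small `t`, the perturbation `x ↦ x + t g(x)` of the identity maps the open unit ball onto
itself: its image is open, and closed in the ball because the sphere is fixed. -/
lemma image_ball_eq {g : E → E} {C t : ℝ} (ht : 0 < t) (ht1 : t < 1)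
    (htC : t * C < 1) (hd : ∀ x ∈ closedBall (0 : E) 1, HasStrictFDerivAt g (fderiv ℝ g x) x)
    (hC : ∀ x ∈ closedBall (0 : E) 1, ‖fderiv ℝ g x‖ ≤ C)
    (hsphere : ∀ x ∈ sphere (0 : E) 1, g x = 0)
    (hmap : ∀ x ∈ closedBall (0 : E) 1, ‖x + g x‖ = 1) :
    (fun x => x + t • g x) '' ball 0 1 = ball 0 1 := by
  set h : E → E := fun x => x + t • g x
  have hmaps : MapsTo h (ball 0 1) (ball 0 1) := by
    intro x hx
    have hx1 : ‖x‖ < 1 := by simpa using hx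
    have : h x = (1 - t) • x + t • (x + g x) := by simp only [h]; module
    rw [mem_ball_zero_iff, this]
    calc _ ≤ ‖(1 - t) • x‖ + ‖t • (x + g x)‖ := norm_add_le _ _
      _ = (1 - t) * ‖x‖ + t := by
        rw [norm_smul, norm_smul, hmap x (ball_subset_closedBall hx), Real.norm_of_nonneg ht.le,
          Real.norm_of_nonneg (by linarith), mul_one]
      _ < 1 := by nlinarith
  refine (hmaps.image_subset).antisymm ?_
  have hhd : ∀ x ∈ closedBall (0 : E) 1, HasStrictFDerivAt h (1 + t • fderiv ℝ g x) x :=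
    fun x hx => (hasStrictFDerivAt_id x).add ((hd x hx).const_smul t)
  have hopen : IsOpen (h '' ball 0 1) := by
    rw [isOpen_iff_mem_nhds]
    rintro _ ⟨x, hx, rfl⟩
    have hx' := ball_subset_closedBall hx
    have hpos : 0 < (1 + t • fderiv ℝ g x).det :=
      det_one_add_smul_pos ht.le (lt_of_le_of_lt (by gcongr; exact hC x hx') htC)
    have hr : (1 + t • fderiv ℝ g x : E →L[ℝ] E).range = ⊤ :=
      (LinearMap.equivOfDetNeZero _ hpos.ne').range
    rw [← (hhd x hx').map_nhds_eq_of_surj hr]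
    exact image_mem_map (isOpen_ball.mem_nhds hx)
  have hcomp : IsCompact (h '' closedBall 0 1) :=
    (isCompact_closedBall _ _).image_of_continuousOn
      fun x hx => (hhd x hx).continuousAt.continuousWithinAt
  refine (convex_ball (0 : E) 1).isPreconnected.subset_of_closure_inter_subset hopen
    ⟨h 0, hmaps (by simp), mem_image_of_mem _ (by simp)⟩ ?_
  rintro y ⟨hy, hyb⟩
  obtain ⟨x, hx, rfl⟩ :=
    closure_minimal (image_mono ball_subset_closedBall) hcomp.isClosed hy
  refine mem_image_of_mem _ ?_
  by_contra hxb
  have hxs : ‖x‖ = 1 := le_antisymm (by simpa using hx) (by simpa using hxb)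
  have : h x = x := by simp [h, hsphere x (by simpa using hxs)]
  rw [this] at hyb
  exact hxb hyb

/-- There is no `C¹` retraction of the closed unit ball onto its sphere. The volume of the image of
the ball under `x + t (f x - x)` equals that of the ball for small `t`; it is a polynomial in `t`,
which vanishes at `t = 1`. -/
theorem no_contDiff_retraction {f : E → E} {U : Set E} (hU : IsOpen U)
    (hBU : closedBall 0 1 ⊆ U) (hf : ContDiffOn ℝ 1 f U)
    (hsphere : ∀ x ∈ sphere (0 : E) 1, f x = x)
    (hmap : ∀ x ∈ closedBall (0 : E) 1, ‖f x‖ = 1) : False := by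
  borelize E
  set g : E → E := fun x => f x - x with hg
  have hgU : ContDiffOn ℝ 1 g U := hf.sub contDiffOn_id
  have hgat : ∀ x ∈ closedBall (0 : E) 1, ContDiffAt ℝ 1 g x :=
    fun x hx => hgU.contDiffAt (hU.mem_nhds (hBU hx))
  have hd : ∀ x ∈ closedBall (0 : E) 1, HasStrictFDerivAt g (fderiv ℝ g x) x :=
    fun x hx => (hgat x hx).hasStrictFDerivAt one_ne_zero
  have hDcont : ContinuousOn (fderiv ℝ g) (closedBall 0 1) :=
    (hgU.continuousOn_fderiv_of_isOpen hU le_rfl).mono hBU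
  obtain ⟨C, hC⟩ := (isCompact_closedBall (0 : E) 1).exists_bound_of_continuousOn hDcont
  have hC0 : 0 ≤ C := (norm_nonneg _).trans (hC 0 (by simp))
  obtain ⟨s, w, hs, hw⟩ := exists_det_interpolation (E := E) (δ := 1 / (C + 1)) (by positivity)
  have hgs : ∀ x ∈ sphere (0 : E) 1, g x = 0 := fun x hx => by simp [hg, hsphere x hx]
  have hgm : ∀ x ∈ closedBall (0 : E) 1, ‖x + g x‖ = 1 := fun x hx => by simp [hg, hmap x hx]
  have hvol : ∀ t ∈ s, ∫ x in ball (0 : E) 1, (1 + t • fderiv ℝ g x).det =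
      volume.real (ball (0 : E) 1) := by
    intro t ht
    obtain ⟨ht0, htδ⟩ := hs t ht
    have htC1 : t * (C + 1) < 1 := by rwa [lt_div_iff₀ (by positivity)] at htδ
    have htC : t * C < 1 := by linarith
    have ht1 : t < 1 := by nlinarith
    have hinj : InjOn (fun x => x + t • g x) (ball 0 1) := by
      intro x hx y hy hxy
      have h1 := (convex_closedBall (0 : E) 1).norm_image_sub_le_of_norm_fderiv_le (𝕜 := ℝ)
        (fun x hx => (hd x hx).differentiableAt) hC (ball_subset_closedBall hx)
        (ball_subset_closedBall hy)
      have h2 : y - x = -(t • (g y - g x)) := by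
        have : x + t • g x = y + t • g y := hxy
        rw [smul_sub, neg_sub, sub_eq_sub_iff_add_eq_add, ← this, add_comm]
      have h3 : ‖y - x‖ ≤ t * C * ‖y - x‖ := by
        calc ‖y - x‖ = t * ‖g y - g x‖ := by
              conv_lhs => rw [h2]
              rw [norm_neg, norm_smul, Real.norm_of_nonneg ht0.le]
          _ ≤ _ := by rw [mul_assoc]; gcongr
      have h4 : ‖y - x‖ = 0 := by
        by_contra hne
        have : 0 < ‖y - x‖ := lt_of_le_of_ne (norm_nonneg _) (Ne.symm hne)
        nlinarith
      exact (sub_eq_zero.1 (norm_eq_zero.1 h4)).symm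
    have key := integral_image_eq_integral_abs_det_fderiv_smul (volume : Measure E)
      (f' := fun x => 1 + t • fderiv ℝ g x) measurableSet_ball
      (fun x hx => ((hasStrictFDerivAt_id x).add
        ((hd x (ball_subset_closedBall hx)).const_smul t)).hasFDerivAt.hasFDerivWithinAt) hinj
      (fun _ => (1 : ℝ))
    change ∫ _ in (fun x => x + t • g x) '' ball 0 1, (1 : ℝ) = _ at key
    rw [image_ball_eq ht0 ht1 htC hd hC hgs hgm] at key
    simp only [integral_const, MeasurableSet.univ, measureReal_restrict_apply, univ_inter,
      smul_eq_mul, mul_one] at key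
    rw [key]
    refine setIntegral_congr_fun measurableSet_ball fun x hx => ?_
    exact (abs_of_pos (det_one_add_smul_pos ht0.le
      (lt_of_le_of_lt (by gcongr; exact hC x (ball_subset_closedBall hx)) htC))).symm
  have hint : ∀ t : ℝ, IntegrableOn (fun x => (1 + t • fderiv ℝ g x).det) (ball (0 : E) 1) := by
    intro t
    refine IntegrableOn.mono_set ?_ (ball_subset_closedBall (x := (0 : E)) (ε := 1))
    refine ContinuousOn.integrableOn_compact (isCompact_closedBall _ _) ?_
    exact ContinuousLinearMap.continuous_det.comp_continuousOn
      (continuousOn_const.add (hDcont.const_smul t))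
  have hw1 : ∑ t ∈ s, w t = 1 := by
    have := hw 0
    simpa [ContinuousLinearMap.det] using this.symm
  -- `f` takes values in the sphere, so `f x` is orthogonal to the range of the derivative of `f`.
  have hzero : ∀ x ∈ ball (0 : E) 1, (1 + fderiv ℝ g x).det = 0 := by
    intro x hx
    have hx' := ball_subset_closedBall hx
    have hfd : HasFDerivAt f (1 + fderiv ℝ g x) x := by
      have := (hasFDerivAt_id x).add (hd x hx').hasFDerivAt
      refine this.congr_of_eventuallyEq (Eventually.of_forall fun y => ?_)
      simp [hg]
    have hns := hfd.norm_sq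
    have hconst : (fun y => ‖f y‖ ^ 2) =ᶠ[𝓝 x] fun _ => (1 : ℝ) := by
      filter_upwards [isOpen_ball.mem_nhds hx] with y hy
      rw [hmap y (ball_subset_closedBall hy), one_pow]
    have h0 := hns.unique ((hasFDerivAt_const (1 : ℝ) x).congr_of_eventuallyEq hconst)
    by_contra hdet
    obtain ⟨v, hv⟩ := (LinearMap.equivOfDetNeZero _ hdet).surjective (f x)
    have hv' : (1 + fderiv ℝ g x) v = f x := hv
    have h1 := congrArg (fun L : E →L[ℝ] ℝ => L v) h0
    simp only [smul_apply, ContinuousLinearMap.comp_apply, hv',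
      innerSL_apply_apply, real_inner_self_eq_norm_sq, hmap x hx'] at h1
    norm_num at h1
  have hfinal : (0 : ℝ) = volume.real (ball (0 : E) 1) := by
    calc (0 : ℝ) = ∫ x in ball (0 : E) 1, (1 + fderiv ℝ g x).det := by
          rw [setIntegral_congr_fun measurableSet_ball hzero]; simp
      _ = ∫ x in ball (0 : E) 1, ∑ t ∈ s, w t * (1 + t • fderiv ℝ g x).det :=
          setIntegral_congr_fun measurableSet_ball fun x _ => hw _
      _ = ∑ t ∈ s, w t * ∫ x in ball (0 : E) 1, (1 + t • fderiv ℝ g x).det := by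
          rw [integral_finsetSum _ fun t _ => (hint t).const_mul _]
          simp_rw [integral_const_mul]
      _ = ∑ t ∈ s, w t * volume.real (ball (0 : E) 1) :=
          Finset.sum_congr rfl fun t ht => by rw [hvol t ht]
      _ = _ := by rw [← Finset.sum_mul, hw1, one_mul]
  have hpos : 0 < volume.real (ball (0 : E) 1) :=
    ENNReal.toReal_pos (measure_ball_pos _ _ one_pos).ne' measure_ball_lt_top.ne
  exact hpos.ne hfinal

end NoRetraction

/-! ### Brouwer's fixed point theorem -/

section Brouwer

variable {E : Type*} [NormedAddCommGroup E] [InnerProductSpace ℝ E] [FiniteDimensional ℝ E]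

/-- A `C¹` map of the closed unit ball into the open one has a fixed point there; otherwise pushing
`x` away from `P x` along a straight line until the sphere is reached is a `C¹` retraction. -/
lemma exists_fixedPoint_of_contDiff {P : E → E} (hP : ContDiff ℝ 1 P) (hP1 : ∀ x, ‖P x‖ < 1) :
    ∃ x ∈ closedBall (0 : E) 1, P x = x := by
  by_contra! hfix
  set a : E → ℝ := fun x => ‖x - P x‖ ^ 2
  set b : E → ℝ := fun x => inner ℝ x (x - P x)
  -- The root `s = (-b + √D) / a` of `‖x + s (x - P x)‖ = 1`.
  set D : E → ℝ := fun x => b x ^ 2 + a x * (1 - ‖x‖ ^ 2)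
  have hsub : ContDiff ℝ 1 fun x => x - P x := contDiff_id.sub hP
  have ha : ContDiff ℝ 1 a := hsub.norm_sq ℝ
  have hb : ContDiff ℝ 1 b := contDiff_id.inner ℝ hsub
  have hD : ContDiff ℝ 1 D :=
    (hb.pow 2).add (ha.mul (contDiff_const.sub (contDiff_id.norm_sq ℝ)))
  have ha0 : ∀ x ∈ closedBall (0 : E) 1, 0 < a x := fun x hx =>
    pow_pos (norm_pos_iff.2 (sub_ne_zero.2 (hfix x hx).symm)) 2
  have hb0 : ∀ x : E, ‖x‖ = 1 → 0 < b x := by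
    intro x hx
    have h1 : inner ℝ x (P x) ≤ ‖x‖ * ‖P x‖ := real_inner_le_norm _ _
    have h2 := hP1 x
    simp only [b, inner_sub_right, real_inner_self_eq_norm_sq]
    rw [hx] at h1 ⊢
    linarith
  have hD0 : ∀ x ∈ closedBall (0 : E) 1, 0 < D x := by
    intro x hx
    have hx1 : ‖x‖ ≤ 1 := by simpa using hx
    rcases hx1.eq_or_lt with h | h
    · have := hb0 x h
      simp only [D, h]
      nlinarith
    · have : 0 < 1 - ‖x‖ ^ 2 := by nlinarith [norm_nonneg x]
      have := mul_pos (ha0 x hx) this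
      simp only [D]
      nlinarith [sq_nonneg (b x)]
  refine no_contDiff_retraction (f := fun x => x + ((-b x + √(D x)) / a x) • (x - P x))
    (U := {x | 0 < a x} ∩ {x | 0 < D x})
    ((isOpen_lt continuous_const ha.continuous).inter (isOpen_lt continuous_const hD.continuous))
    (fun x hx => ⟨ha0 x hx, hD0 x hx⟩) ?_ ?_ ?_
  · intro x hx
    have hs : ContDiffAt ℝ 1 (fun x => (-b x + √(D x)) / a x) x :=
      (hb.contDiffAt.neg.add (hD.contDiffAt.sqrt hx.2.ne')).div ha.contDiffAt hx.1.ne'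
    exact (contDiffAt_id.add (hs.smul hsub.contDiffAt)).contDiffWithinAt
  · intro x hx
    have hx1 : ‖x‖ = 1 := by simpa using hx
    have : √(D x) = b x := by
      simp only [D, hx1]
      norm_num
      exact Real.sqrt_sq (hb0 x hx1).le
    simp [this]
  · intro x hx
    have hax := ha0 x hx
    set s := (-b x + √(D x)) / a x with hs
    have has : a x * s = -b x + √(D x) := by rw [hs]; field_simp
    have hsq : (a x * s + b x) ^ 2 = D x := by
      rw [has, neg_add_cancel_comm, Real.sq_sqrt (hD0 x hx).le]
    have h1 : ‖x + s • (x - P x)‖ ^ 2 = 1 := by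
      rw [norm_add_sq_real, inner_smul_right, norm_smul, mul_pow, Real.norm_eq_abs, sq_abs]
      change ‖x‖ ^ 2 + 2 * (s * b x) + s ^ 2 * a x = 1
      simp only [D] at hsq
      have : a x * (‖x‖ ^ 2 + 2 * (s * b x) + s ^ 2 * a x - 1) = 0 := by linear_combination hsq
      have := (mul_eq_zero.1 this).resolve_left hax.ne'
      linarith
    exact (pow_eq_one_iff_of_nonneg (norm_nonneg _) two_ne_zero).1 h1

/-- **Brouwer's fixed point theorem** for maps into the unit ball of a Euclidean space. -/
theorem exists_fixedPoint_of_norm_le_one {F : E → E} (hF : Continuous F) (hF1 : ∀ x, ‖F x‖ ≤ 1) :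
    ∃ x, F x = x := by
  by_contra! hfix
  obtain ⟨x₀, -, hx₀⟩ := (isCompact_closedBall (0 : E) 1).exists_isMinOn ⟨0, by simp⟩
    ((hF.sub continuous_id).norm.continuousOn)
  set ε := ‖F x₀ - x₀‖ / 2 with hε
  have hε0 : 0 < ε := half_pos (norm_pos_iff.2 (sub_ne_zero.2 (hfix x₀)))
  obtain ⟨Q, hQ, hQF, -⟩ := hF.exists_contDiff_approx (ε := fun _ => ε) 1 continuous_const
    fun _ => hε0
  -- Rescaling brings the smooth approximation back into the ball.
  have hQ1 : ∀ x, ‖Q x‖ < 1 + ε := by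
    intro x
    have h1 := norm_le_norm_add_norm_sub' (Q x) (F x)
    have h2 := hQF x
    rw [dist_eq_norm] at h2
    linarith [hF1 x]
  have hP1 : ∀ x, ‖(1 + ε)⁻¹ • Q x‖ < 1 := by
    intro x
    rw [norm_smul, norm_inv, Real.norm_of_nonneg (by linarith), inv_mul_lt_one₀ (by linarith)]
    exact hQ1 x
  obtain ⟨x, hx, hPx⟩ := exists_fixedPoint_of_contDiff
    (P := fun x => (1 + ε)⁻¹ • Q x) (contDiff_const.smul hQ) hP1
  have h1 : ‖F x₀ - x₀‖ ≤ ‖F x - x‖ := hx₀ hx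
  have hQx : Q x = (1 + ε) • x := by
    rw [inv_smul_eq_iff₀ (by linarith)] at hPx
    exact hPx
  have h2 := hQF x
  have hx1 : ‖x‖ ≤ 1 := by simpa using hx
  have h3 : ‖F x - x‖ ≤ ‖Q x - F x‖ + ‖ε • x‖ := by
    have : F x - x = -(Q x - F x) + ε • x := by rw [hQx]; module
    rw [this, ← norm_neg (Q x - F x)]
    exact norm_add_le _ _
  rw [dist_eq_norm] at h2
  rw [norm_smul, Real.norm_of_nonneg hε0.le] at h3
  nlinarith

end Brouwer

/-! ### The Knaster–Kuratowski–Mazurkiewicz lemma -/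

section KKM

variable {ι : Type*} [Fintype ι]

/-- The retraction onto the standard simplex used here shifts a point along the diagonal to the
hyperplane of coordinate sum `1`, takes positive parts and normalizes. -/
lemma exists_continuous_retraction_stdSimplex [Nonempty ι] :
    ∃ r : (ι → ℝ) → ι → ℝ, Continuous r ∧ (∀ x, r x ∈ stdSimplex ℝ ι) ∧
      ∀ x ∈ stdSimplex ℝ ι, r x = x := by
  let y : (ι → ℝ) → ι → ℝ := fun x i => x i + (1 - ∑ j, x j) / Fintype.card ι
  have hy : Continuous y := by fun_prop
  have hsum : ∀ x, ∑ i, y x i = 1 := by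
    intro x
    have : (Fintype.card ι : ℝ) ≠ 0 := by exact_mod_cast Fintype.card_ne_zero
    simp only [y, Finset.sum_add_distrib, Finset.sum_const, Finset.card_univ, nsmul_eq_mul]
    field_simp
    ring
  have hpos : ∀ x, 1 ≤ ∑ j, max (y x j) 0 := fun x =>
    (hsum x).symm.le.trans (Finset.sum_le_sum fun i _ => le_max_left _ _)
  refine ⟨fun x i => max (y x i) 0 / ∑ j, max (y x j) 0, ?_, fun x => ⟨fun i => ?_, ?_⟩, ?_⟩
  · refine continuous_pi fun i => Continuous.div (by fun_prop) (by fun_prop) fun x => ?_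
    linarith [hpos x]
  · exact div_nonneg (le_max_right _ _) (by linarith [hpos x])
  · rw [← Finset.sum_div, div_self (by linarith [hpos x])]
  · intro x hx
    have hyx : ∀ i, max (y x i) 0 = x i := by
      intro i
      simp only [y, hx.2, sub_self, zero_div, add_zero]
      exact max_eq_left (hx.1 i)
    funext i
    simp only [hyx, hx.2, div_one]

lemma norm_toLp_le_one_of_mem_stdSimplex {x : ι → ℝ} (hx : x ∈ stdSimplex ℝ ι) :
    ‖WithLp.toLp 2 x‖ ≤ 1 := by
  rw [← sq_le_one_iff₀ (norm_nonneg _), EuclideanSpace.norm_sq_eq, ← hx.2]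
  refine Finset.sum_le_sum fun i _ => ?_
  have h1 : x i ≤ 1 := hx.2 ▸ Finset.single_le_sum (fun j _ => hx.1 j) (Finset.mem_univ i)
  simp only [Real.norm_eq_abs, sq_abs]
  nlinarith [hx.1 i]

/-- Brouwer's theorem on the standard simplex. -/
theorem exists_fixedPoint_stdSimplex [Nonempty ι] {G : (ι → ℝ) → ι → ℝ} (hG : Continuous G)
    (hmaps : ∀ x ∈ stdSimplex ℝ ι, G x ∈ stdSimplex ℝ ι) :
    ∃ x ∈ stdSimplex ℝ ι, G x = x := by
  obtain ⟨r, hr, hrmem, hrid⟩ := exists_continuous_retraction_stdSimplex (ι := ι)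
  obtain ⟨x, hx⟩ := exists_fixedPoint_of_norm_le_one
    (F := fun x : EuclideanSpace ℝ ι => WithLp.toLp 2 (G (r x.ofLp))) (by fun_prop)
    fun x => norm_toLp_le_one_of_mem_stdSimplex (hmaps _ (hrmem _))
  have hx' : G (r x.ofLp) = x.ofLp := congrArg WithLp.ofLp hx
  have hmem : x.ofLp ∈ stdSimplex ℝ ι := hx' ▸ hmaps _ (hrmem _)
  exact ⟨x.ofLp, hmem, by rwa [hrid _ hmem] at hx'⟩

/-- **Knaster–Kuratowski–Mazurkiewicz lemma**: if closed sets cover the simplex so that every point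
lies in a set whose index is a vertex of the smallest face containing it, then they have a common
point. It is a fixed point of `x ↦ (x + d x) / (1 + ∑ d x)`, `d x` being the distances of `x` to the
sets. -/
theorem exists_mem_stdSimplex_forall_mem [Nonempty ι] {F : ι → Set (ι → ℝ)}
    (hF : ∀ i, IsClosed (F i)) (hcover : ∀ x ∈ stdSimplex ℝ ι, ∃ i, 0 < x i ∧ x ∈ F i) :
    ∃ x ∈ stdSimplex ℝ ι, ∀ i, x ∈ F i := by
  classical
  have hne : ∀ i, (F i).Nonempty := by
    intro i
    obtain ⟨j, hj, hmem⟩ := hcover _ (single_mem_stdSimplex ℝ i)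
    have : j = i := by
      by_contra h
      simp [h] at hj
    exact ⟨_, this ▸ hmem⟩
  set d : (ι → ℝ) → ι → ℝ := fun x i => infDist x (F i)
  have hd : Continuous d := continuous_pi fun i => continuous_infDist_pt _
  have hd0 : ∀ x i, 0 ≤ d x i := fun x i => infDist_nonneg
  have hS0 : ∀ x, 0 ≤ ∑ j, d x j := fun x => Finset.sum_nonneg fun i _ => hd0 x i
  obtain ⟨x, hx, hfix⟩ := exists_fixedPoint_stdSimplex
    (G := fun x i => (x i + d x i) / (1 + ∑ j, d x j))
    (by
      refine continuous_pi fun i => Continuous.div (by fun_prop) (by fun_prop) fun x => ?_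
      linarith [hS0 x])
    (by
      refine fun x hx => ⟨fun i => div_nonneg (add_nonneg (hx.1 i) (hd0 x i))
        (by linarith [hS0 x]), ?_⟩
      rw [← Finset.sum_div, Finset.sum_add_distrib, hx.2, div_self (by linarith [hS0 x])])
  have hdx : ∀ i, d x i = x i * ∑ j, d x j := by
    intro i
    have : (x i + d x i) / (1 + ∑ j, d x j) = x i := congrFun hfix i
    rw [div_eq_iff (by linarith [hS0 x])] at this
    linarith
  obtain ⟨i, hi, hmem⟩ := hcover x hx
  have hzero : ∑ j, d x j = 0 := by
    have h0 : d x i = 0 := infDist_zero_of_mem hmem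
    exact (mul_eq_zero.1 ((hdx i).symm.trans h0)).resolve_left hi.ne'
  refine ⟨x, hx, fun j => ((hF j).mem_iff_infDist_zero (hne j)).2 ?_⟩
  change d x j = 0
  rw [hdx, hzero, mul_zero]

end KKM

/-! ### Sequences in the weak topology of a reflexive space -/

section WeakTopology

variable {V : Type*} [NormedAddCommGroup V] [NormedSpace ℝ V]

lemma continuous_eval_toWeakSpace_symm (f : StrongDual ℝ V) :
    Continuous fun x : WeakSpace ℝ V => f ((toWeakSpace ℝ V).symm x) :=
  WeakBilin.eval_continuous (topDualPairing ℝ V).flip f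

lemma weaklyConverges_iff {u : ℕ → V} {x : V} :
    WeaklyConverges u x ↔ ∀ f : StrongDual ℝ V, Tendsto (fun n => f (u n)) atTop (𝓝 (f x)) := by
  refine ⟨fun h f => ((continuous_eval_toWeakSpace_symm f).tendsto _).comp h, fun h => ?_⟩
  refine (WeakBilin.tendsto_iff_forall_eval_tendsto (topDualPairing ℝ V).flip ?_).2 h
  intro y z hyz
  by_contra hne
  obtain ⟨f, hf⟩ := SeparatingDual.exists_separating_of_ne (R := ℝ) hne
  exact hf (DFunLike.congr_fun hyz f)

/-- Bounded sets of a reflexive space are relatively weakly compact. -/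
lemma IsReflexive.isCompact_closure (hV : IsReflexive V) {S : Set V}
    (hS : Bornology.IsBounded S) : IsCompact (closure (toWeakSpace ℝ V '' S)) := by
  refine NormedSpace.isCompact_closure_of_isBounded ℝ V _ ?_ ?_
  · rwa [preimage_image_eq _ (toWeakSpace ℝ V).injective]
  · intro F _
    obtain ⟨x, hx⟩ := hV F.toStrongDual
    exact ⟨toWeakSpace ℝ V x, congrArg StrongDual.toWeakDual hx⟩

/-- A closed convex set is weakly closed. -/
lemma toWeakSpace_mem_closure_iff {C : Set V} (hC : Convex ℝ C) (hCc : IsClosed C) {x : V} :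
    toWeakSpace ℝ V x ∈ closure (toWeakSpace ℝ V '' C) ↔ x ∈ C := by
  rw [← hC.toWeakSpace_closure ℝ, hCc.closure_eq, (toWeakSpace ℝ V).injective.mem_set_image]

/-- A separable set is separated from the origin by countably many functionals, norming those of a
countable dense subset. -/
lemma exists_seq_dual_separating {S : Set V} (hS : TopologicalSpace.IsSeparable S) :
    ∃ f : ℕ → StrongDual ℝ V, (∀ k, ‖f k‖ ≤ 1) ∧ ∀ x ∈ S, (∀ k, f k x = 0) → x = 0 := by
  obtain ⟨c, hc, hSc⟩ := hS
  obtain ⟨d, hd⟩ := (hc.insert 0).exists_eq_range (insert_nonempty _ _)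
  choose f hf1 hf2 using fun k => exists_dual_vector'' ℝ (d k)
  refine ⟨f, hf1, fun x hx h0 => ?_⟩
  rw [← norm_eq_zero]
  refine le_antisymm (le_of_forall_pos_le_add fun ε hε => ?_) (norm_nonneg x)
  obtain ⟨y, hy, hxy⟩ := Metric.mem_closure_iff.1 (hSc hx) (ε / 2) (half_pos hε)
  obtain ⟨k, rfl⟩ : y ∈ range d := hd ▸ mem_insert_of_mem _ hy
  have h1 : ‖d k‖ ≤ ‖d k - x‖ := by
    have h2 : f k (d k - x) = ‖d k‖ := by rw [map_sub, h0, sub_zero, hf2]; rfl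
    calc ‖d k‖ = f k (d k - x) := h2.symm
      _ ≤ ‖f k (d k - x)‖ := Real.le_norm_self _
      _ ≤ 1 * ‖d k - x‖ := (f k).le_of_opNorm_le (hf1 k) _
      _ = _ := one_mul _
  rw [dist_eq_norm, norm_sub_rev] at hxy
  have := norm_le_norm_add_norm_sub (d k) x
  linarith

lemma eval_eq_of_mapClusterPt {s : ℕ → V} {x : V} (f : StrongDual ℝ V) {a : ℝ}
    (hx : MapClusterPt (toWeakSpace ℝ V x) atTop fun n => toWeakSpace ℝ V (s n))
    (ha : Tendsto (fun n => f (s n)) atTop (𝓝 a)) : f x = a := by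
  have h : MapClusterPt (f x) atTop fun n => f (s n) :=
    hx.continuousAt_comp (f := fun z => f ((toWeakSpace ℝ V).symm z))
      (continuous_eval_toWeakSpace_symm f).continuousAt
  exact eq_of_nhds_neBot (h.clusterPt.mono ha)

/-- Weak convergence of a bounded sequence in a closed subspace can be tested on countably many
functionals that are separating on the subspace: they identify every weak cluster point. -/
lemma IsReflexive.weaklyConverges_of_separating (hV : IsReflexive V) {X : Submodule ℝ V}
    (hX : IsClosed (X : Set V)) {f : ℕ → StrongDual ℝ V}
    (hf : ∀ x ∈ X, (∀ k, f k x = 0) → x = 0) {s : ℕ → V} (hsb : Bornology.IsBounded (range s))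
    (hs : ∀ n, s n ∈ X) {x : V} (hx : x ∈ X)
    (hlim : ∀ k, Tendsto (fun n => f k (s n)) atTop (𝓝 (f k x))) : WeaklyConverges s x := by
  refine (hV.isCompact_closure hsb).tendsto_nhds_of_unique_mapClusterPt
    (Eventually.of_forall fun n => subset_closure (mem_image_of_mem _ (mem_range_self n)))
    fun y hy hcl => ?_
  obtain ⟨y, rfl⟩ := (toWeakSpace ℝ V).surjective y
  have hyX : y ∈ X := (toWeakSpace_mem_closure_iff X.convex hX).1
    (closure_mono (image_mono (range_subset_iff.2 hs)) hy)
  have hyx : y - x = 0 := by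
    refine hf _ (X.sub_mem hyX hx) fun k => ?_
    rw [map_sub, sub_eq_zero]
    exact eval_eq_of_mapClusterPt (f k) hcl (hlim k)
  rw [sub_eq_zero.1 hyx]

lemma isSeparable_closure_span {S : Set V} (hS : S.Countable) :
    TopologicalSpace.IsSeparable ((Submodule.span ℝ S).topologicalClosure : Set V) := by
  rw [Submodule.topologicalClosure_coe]
  exact (hS.isSeparable.span (R := ℝ)).closure

/-- Bounded sequences of a reflexive space have weakly convergent subsequences. -/
theorem IsReflexive.exists_subseq_weaklyConverges (hV : IsReflexive V) {s : ℕ → V}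
    (hs : Bornology.IsBounded (range s)) :
    ∃ (x : V) (k : ℕ → ℕ), StrictMono k ∧ WeaklyConverges (s ∘ k) x := by
  set X := (Submodule.span ℝ (range s)).topologicalClosure
  have hXc : IsClosed (X : Set V) := Submodule.isClosed_topologicalClosure _
  have hsX : ∀ n, s n ∈ X := fun n =>
    Submodule.le_topologicalClosure _ (Submodule.subset_span (mem_range_self n))
  obtain ⟨f, hf1, hf⟩ := exists_seq_dual_separating (isSeparable_closure_span (countable_range s))
  obtain ⟨C, hC⟩ := hs.exists_norm_le
  have hCs : ∀ n, ‖s n‖ ≤ C := fun n => hC _ (mem_range_self n)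
  -- A diagonal subsequence along which every `f k` converges.
  obtain ⟨a, -, k, hk, hlim⟩ := (isCompact_univ_pi fun _ : ℕ =>
    isCompact_closedBall (0 : ℝ) C).tendsto_subseq (x := fun n i => f i (s n)) fun n i _ => by
      rw [mem_closedBall_zero_iff]
      calc ‖f i (s n)‖ ≤ 1 * ‖s n‖ := (f i).le_of_opNorm_le (hf1 i) _
        _ ≤ C := by rw [one_mul]; exact hCs n
  rw [tendsto_pi_nhds] at hlim
  have hkb : Bornology.IsBounded (range (s ∘ k)) := hs.subset (range_comp_subset_range _ _)
  obtain ⟨y, hy, hcl⟩ := (hV.isCompact_closure hkb).exists_mapClusterPt (f := atTop)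
    (u := fun n => toWeakSpace ℝ V (s (k n)))
    (tendsto_principal.2 (Eventually.of_forall fun n =>
      subset_closure (mem_image_of_mem _ (mem_range_self n))))
  obtain ⟨x, rfl⟩ := (toWeakSpace ℝ V).surjective y
  have hxX : x ∈ X := (toWeakSpace_mem_closure_iff X.convex hXc).1
    (closure_mono (image_mono (range_subset_iff.2 fun n => hsX (k n))) hy)
  refine ⟨x, k, hk, hV.weaklyConverges_of_separating hXc hf hkb (fun n => hsX (k n)) hxX
    fun i => ?_⟩
  rw [eval_eq_of_mapClusterPt (f i) hcl (hlim i)]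
  exact hlim i

/-- Countable tightness of the weak topology, one step: the weak closeness of `x` to `S` on all
`n`-tuples of functionals in the unit ball is witnessed by finitely many elements of `S`. -/
lemma exists_finite_subset_forall_lt {S : Set V} {x : V}
    (hx : toWeakSpace ℝ V x ∈ closure (toWeakSpace ℝ V '' S)) (n : ℕ) {ε : ℝ} (hε : 0 < ε) :
    ∃ T ⊆ S, T.Finite ∧ ∀ f : Fin n → StrongDual ℝ V, (∀ i, ‖f i‖ ≤ 1) →
      ∃ s ∈ T, ∀ i, |f i s - f i x| < ε := by
  let B : Set (Fin n → WeakDual ℝ V) :=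
    univ.pi fun _ => WeakDual.toStrongDual ⁻¹' Metric.closedBall 0 1
  have hB : IsCompact B := isCompact_univ_pi fun _ => WeakDual.isCompact_closedBall 0 1
  let U : S → Set (Fin n → WeakDual ℝ V) := fun s => {f | ∀ i, |f i s - f i x| < ε}
  have hU : ∀ s, IsOpen (U s) := by
    intro s
    simp only [U, ofPred_forall]
    refine isOpen_iInter_of_finite fun i => isOpen_lt ?_ continuous_const
    exact (((WeakDual.eval_continuous (s : V)).comp (continuous_apply i)).sub
      ((WeakDual.eval_continuous x).comp (continuous_apply i))).abs
  have hcov : B ⊆ ⋃ s, U s := by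
    intro f _
    have hopen : IsOpen {z : WeakSpace ℝ V |
        ∀ i, |f i ((toWeakSpace ℝ V).symm z) - f i x| < ε} := by
      simp only [ofPred_forall]
      exact isOpen_iInter_of_finite fun i => isOpen_lt
        ((continuous_eval_toWeakSpace_symm (f i).toStrongDual).sub continuous_const).abs
        continuous_const
    obtain ⟨_, hz, s, hs, rfl⟩ := mem_closure_iff.1 hx _ hopen (by intro i; simpa using hε)
    exact mem_iUnion.2 ⟨⟨s, hs⟩, hz⟩
  obtain ⟨t, ht⟩ := hB.elim_finite_subcover U hU hcov
  refine ⟨Subtype.val '' (t : Set S), by rintro _ ⟨s, -, rfl⟩; exact s.2,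
    t.finite_toSet.image _, fun f hf => ?_⟩
  have hmem : (fun i => StrongDual.toWeakDual (f i)) ∈ B := fun i _ =>
    mem_closedBall_zero_iff.2 (hf i)
  obtain ⟨s, hst, hs⟩ := mem_iUnion₂.1 (ht hmem)
  exact ⟨s, mem_image_of_mem _ hst, hs⟩

/-- In a reflexive space, the weak closure of a bounded set consists of limits of weakly convergent
sequences of the set. -/
theorem IsReflexive.exists_seq_weaklyConverges (hV : IsReflexive V) {S : Set V}
    (hS : Bornology.IsBounded S) {x : V}
    (hx : toWeakSpace ℝ V x ∈ closure (toWeakSpace ℝ V '' S)) :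
    ∃ u : ℕ → V, (∀ n, u n ∈ S) ∧ WeaklyConverges u x := by
  have hpos : ∀ n : ℕ, (0 : ℝ) < 1 / (n + 1) := fun n => Nat.one_div_pos_of_nat
  choose T hTS hTfin hT using fun n : ℕ => exists_finite_subset_forall_lt hx n (hpos n)
  set X := (Submodule.span ℝ (insert x (⋃ n, T n))).topologicalClosure
  have hXc : IsClosed (X : Set V) := Submodule.isClosed_topologicalClosure _
  have hsub : insert x (⋃ n, T n) ⊆ X :=
    Submodule.subset_span.trans (Submodule.le_topologicalClosure _)
  obtain ⟨f, hf1, hf⟩ := exists_seq_dual_separating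
    (isSeparable_closure_span ((countable_iUnion fun n => (hTfin n).countable).insert x))
  choose u huT hu using fun n => hT n (fun i => f i) fun i => hf1 i
  have huS : ∀ n, u n ∈ S := fun n => hTS n (huT n)
  refine ⟨u, huS, hV.weaklyConverges_of_separating hXc hf (hS.subset (range_subset_iff.2 huS))
    (fun n => hsub (mem_insert_of_mem _ (mem_iUnion.2 ⟨n, huT n⟩))) (hsub (mem_insert _ _))
    fun k => ?_⟩
  rw [tendsto_iff_dist_tendsto_zero]
  refine squeeze_zero' (Eventually.of_forall fun _ => dist_nonneg) ?_
    tendsto_one_div_add_atTop_nhds_zero_nat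
  filter_upwards [eventually_gt_atTop k] with n hn
  exact (hu n ⟨k, hn⟩).le

end WeakTopology

/-! ### Equilibrium problems on bounded convex sets -/

variable {V : Type*} [NormedAddCommGroup V] [NormedSpace ℝ V]

section Equilibrium

/-- The equilibrium inequality for finitely many test points: the KKM lemma applies on the simplex
spanned by them. -/
lemma exists_forall_mem_finset_nonneg {K : Set V} (hK : Convex ℝ K) {ψ : V → V → ℝ}
    (hdiag : ∀ u ∈ K, ψ u u = 0) (hconv : ∀ u ∈ K, ConvexOn ℝ K (ψ u)) (husc : IsFiniteDimUSC K ψ)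
    (T : Finset K) (hT : T.Nonempty) : ∃ u ∈ K, ∀ v ∈ T, 0 ≤ ψ u v := by
  have : Nonempty T := hT.to_subtype
  let x : (T → ℝ) → V := fun l => ∑ j, l j • (j : V)
  have hx : Continuous x := by fun_prop
  have hxK : ∀ l ∈ stdSimplex ℝ T, x l ∈ K := fun l hl =>
    hK.sum_mem (fun i _ => hl.1 i) hl.2 fun i _ => i.1.2
  let W : Submodule ℝ V := Submodule.span ℝ (range fun i : T => (i : V))
  have : FiniteDimensional ℝ W := FiniteDimensional.span_of_finite ℝ (finite_range _)
  have hxW : ∀ l, x l ∈ W := fun l =>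
    W.sum_mem fun i _ => W.smul_mem _ (Submodule.subset_span (mem_range_self i))
  obtain ⟨l, hl, hlF⟩ := exists_mem_stdSimplex_forall_mem
    (F := fun i : T => {l ∈ stdSimplex ℝ T | 0 ≤ ψ (x l) i})
    (fun i => by
      refine isClosed_of_closure_subset fun l hl => ?_
      have hls : l ∈ stdSimplex ℝ T :=
        closure_minimal (sep_subset _ _) (isClosed_stdSimplex ℝ T) hl
      refine ⟨hls, ?_⟩
      by_contra! hneg
      have h1 := husc i i.1.2 W inferInstance (x l) ⟨hxK l hls, hxW l⟩ 0 hneg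
      have h2 : Tendsto x (𝓝[stdSimplex ℝ T] l) (𝓝[K ∩ W] (x l)) :=
        tendsto_nhdsWithin_iff.2 ⟨(hx.tendsto l).mono_left nhdsWithin_le_nhds,
          eventually_mem_nhdsWithin.mono fun m hm => ⟨hxK m hm, hxW m⟩⟩
      have h3 := eventually_nhdsWithin_iff.1 (h2.eventually h1)
      obtain ⟨m, ⟨hms, hm0⟩, hm⟩ := ((mem_closure_iff_frequently.1 hl).and_eventually h3).exists
      exact (hm hms).not_ge hm0)
    (fun l hl => by
      by_contra! hneg
      have hneg' : ∀ i, 0 < l i → ψ (x l) i < 0 := fun i hi => by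
        by_contra! h
        exact hneg i hi ⟨hl, h⟩
      have h1 : ψ (x l) (x l) ≤ ∑ i, l i • ψ (x l) i :=
        (hconv _ (hxK l hl)).map_sum_le (fun i _ => hl.1 i) hl.2 fun i _ => i.1.2
      rw [hdiag _ (hxK l hl)] at h1
      obtain ⟨i, hi⟩ : ∃ i, 0 < l i := by
        by_contra! h
        have := Finset.sum_nonpos fun i (_ : i ∈ Finset.univ) => h i
        rw [hl.2] at this
        linarith
      have h2 : ∑ i, l i • ψ (x l) i < ∑ _i : T, (0 : ℝ) := by
        refine Finset.sum_lt_sum (fun j _ => ?_) ⟨i, Finset.mem_univ i, ?_⟩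
        · rcases (hl.1 j).eq_or_lt with h | h
          · rw [← h, zero_smul]
          · exact (mul_neg_of_pos_of_neg h (hneg' j h)).le
        · exact mul_neg_of_pos_of_neg hi (hneg' i hi)
      simp only [Finset.sum_const_zero] at h2
      linarith)
  exact ⟨x l, hxK l hl, fun v hv => (hlF ⟨v, hv⟩).2⟩

/-- Existence for equilibrium problems on bounded convex sets of a reflexive space. The points
satisfying the inequality for a finite set of test points form a directed family of nonempty sets;
a common point `u` of their weak closures is a solution, since for each `v` a sequence of points
which satisfy the inequality for both `u` and `v` converges weakly to `u`. -/
theorem IsReflexive.exists_equilibrium (hV : IsReflexive V) {K : Set V} (hKc : IsClosed K)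
    (hK : Convex ℝ K) (hKne : K.Nonempty) (hKb : Bornology.IsBounded K) {ψ : V → V → ℝ}
    (hdiag : ∀ u ∈ K, ψ u u = 0) (hconv : ∀ u ∈ K, ConvexOn ℝ K (ψ u)) (husc : IsFiniteDimUSC K ψ)
    (hpm : ∀ (u : ℕ → V), ∀ x ∈ K, ∀ v ∈ K, (∀ n, u n ∈ K) → WeaklyConverges u x →
      (∀ n, 0 ≤ ψ (u n) x) → (∀ n, 0 ≤ ψ (u n) v) → 0 ≤ ψ x v) :
    ∃ u ∈ K, ∀ v ∈ K, 0 ≤ ψ u v := by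
  classical
  let S : Finset K → Set V := fun T => {u ∈ K | ∀ v ∈ T, 0 ≤ ψ u v}
  have hSb : ∀ T, Bornology.IsBounded (S T) := fun T => hKb.subset (sep_subset _ _)
  have hSanti : Antitone S := fun T T' h u hu => ⟨hu.1, fun v hv => hu.2 v (h hv)⟩
  obtain ⟨a, ha⟩ := hKne
  have hSne : ∀ T, (S T).Nonempty := by
    intro T
    obtain ⟨u, hu, huT⟩ := exists_forall_mem_finset_nonneg hK hdiag hconv husc
      (insert ⟨a, ha⟩ T) (Finset.insert_nonempty _ _)
    exact ⟨u, hu, fun v hv => huT v (Finset.mem_insert_of_mem hv)⟩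
  obtain ⟨u, hu⟩ := IsCompact.nonempty_iInter_of_directed_nonempty_isCompact_isClosed
    (fun T => closure (toWeakSpace ℝ V '' S T))
    (directed_of_isDirected_le fun T T' h => closure_mono (image_mono (hSanti h)))
    (fun T => ((hSne T).image _).closure) (fun T => hV.isCompact_closure (hSb T))
    fun T => isClosed_closure
  obtain ⟨u, rfl⟩ := (toWeakSpace ℝ V).surjective u
  rw [mem_iInter] at hu
  have huK : u ∈ K := (toWeakSpace_mem_closure_iff hK hKc).1
    (closure_mono (image_mono (sep_subset _ _)) (hu ∅))
  refine ⟨u, huK, fun v hv => ?_⟩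
  obtain ⟨s, hs, hsu⟩ := hV.exists_seq_weaklyConverges (hSb _) (hu {⟨u, huK⟩, ⟨v, hv⟩})
  exact hpm s u huK v hv (fun n => (hs n).1) hsu
    (fun n => (hs n).2 ⟨u, huK⟩ (by simp)) fun n => (hs n).2 ⟨v, hv⟩ (by simp)

end Equilibrium

/-! ### Variational inequalities on bounded sets and recession directions -/

section Existence

/-- A positive semidefinite linear operator defined everywhere is continuous, by the closed graph
theorem. -/
lemma continuous_of_nonneg [CompleteSpace V] {A : V →ₗ[ℝ] StrongDual ℝ V} (hA : ∀ v, 0 ≤ A v v) :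
    Continuous A := by
  refine A.continuous_of_seq_closed_graph fun u x f hu hf => ?_
  have key : ∀ y, 0 ≤ (f - A y) (x - y) := by
    intro y
    have h1 : Tendsto (fun n => (A (u n) - A y) (u n - y)) atTop (𝓝 ((f - A y) (x - y))) := by
      have h2 : Tendsto (fun n => (A (u n) - A y, u n - y)) atTop (𝓝 (f - A y, x - y)) :=
        Tendsto.prodMk_nhds (hf.sub_const _) (hu.sub_const y)
      exact (isBoundedBilinearMap_apply.continuous.tendsto _).comp h2
    refine ge_of_tendsto' h1 fun n => ?_
    rw [← map_sub]
    exact hA _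
  -- Minty's trick: test with `y = x + t z` and let `t` tend to `0`.
  have key2 : ∀ z, (f - A x) z ≤ 0 := by
    intro z
    have h1 : ∀ t : ℝ, 0 < t → (f - A x) z ≤ t * A z z := by
      intro t ht
      have h := key (x + t • z)
      have h2 : (f - A (x + t • z)) (x - (x + t • z)) = t * (t * A z z - (f - A x) z) := by
        simp only [map_add, map_smul, sub_add_cancel_left, map_neg, sub_apply,
          add_apply, smul_apply, smul_eq_mul]
        ring
      rw [h2] at h
      linarith [nonneg_of_mul_nonneg_right h ht]
    have h3 : Tendsto (fun t : ℝ => t * A z z) (𝓝[>] 0) (𝓝 0) := by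
      have : Tendsto (fun t : ℝ => t * A z z) (𝓝 0) (𝓝 (0 * A z z)) :=
        (continuous_mul_const _).tendsto 0
      rw [zero_mul] at this
      exact this.mono_left nhdsWithin_le_nhds
    exact ge_of_tendsto h3 (eventually_mem_nhdsWithin.mono fun t ht => h1 t ht)
  refine sub_eq_zero.1 (ContinuousLinearMap.ext fun z => le_antisymm (key2 z) ?_)
  have := key2 (-z)
  rw [map_neg] at this
  exact neg_nonpos.1 this

/-- Semicoercivity makes `A` monotone, which lets the quadratic part of the problem pass to weak
limits together with `φ`. -/
lemma nonneg_of_weaklyConverges {A : V →ₗ[ℝ] StrongDual ℝ V} (hAc : Continuous A)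
    (hA : ∀ v, 0 ≤ A v v) {K : Set V} {φ : V → V → ℝ} (hφ : IsPseudomonotoneBifunction K φ)
    (g : StrongDual ℝ V) {u : ℕ → V} {x v : V} (hu : ∀ n, u n ∈ K) (hx : x ∈ K) (hv : v ∈ K)
    (hux : WeaklyConverges u x) (h1 : ∀ n, g (x - u n) ≤ A (u n) (x - u n) + φ (u n) x)
    (h2 : ∀ n, g (v - u n) ≤ A (u n) (v - u n) + φ (u n) v) :
    g (v - x) ≤ A x (v - x) + φ x v := by
  rw [weaklyConverges_iff] at hux
  have hAev : ∀ z, Tendsto (fun n => A (u n) z) atTop (𝓝 (A x z)) := fun z =>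
    hux ((ContinuousLinearMap.apply ℝ ℝ z).comp (⟨A, hAc⟩ : V →L[ℝ] StrongDual ℝ V))
  have hmon : ∀ n, A x (u n) + A (u n) x - A x x ≤ A (u n) (u n) := by
    intro n
    have := hA (u n - x)
    simp only [map_sub, sub_apply] at this
    linarith
  have hlim : 0 ≤ liminf (fun n => (φ (u n) x : EReal)) atTop := by
    have ha : Tendsto (fun n => (((g x - g (u n)) - (A x x - A x (u n)) : ℝ) : EReal)) atTop
        (𝓝 ((0 : ℝ) : EReal)) := by
      refine (continuous_coe_real_ereal.tendsto _).comp ?_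
      have := ((hux g).const_sub (g x)).sub ((hux (A x)).const_sub (A x x))
      simpa using this
    rw [← EReal.coe_zero, ← ha.liminf_eq]
    refine liminf_le_liminf (Eventually.of_forall fun n => EReal.coe_le_coe_iff.2 ?_)
    have := h1 n
    simp only [map_sub] at this
    linarith [hmon n]
  have hlimsup := hφ u x hu hx (weaklyConverges_iff.2 hux) hlim v hv
  have hb : Tendsto (fun n => (((g v - g (u n)) - A (u n) v + (A x (u n) + A (u n) x - A x x) : ℝ) :
      EReal)) atTop (𝓝 (((g v - g x) - A x v + (A x x + A x x - A x x) : ℝ) : EReal)) :=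
    (continuous_coe_real_ereal.tendsto _).comp <|
      (((hux g).const_sub (g v)).sub (hAev v)).add
        (((hux (A x)).add (hAev x)).sub_const (A x x))
  have hle : (((g v - g x) - A x v + (A x x + A x x - A x x) : ℝ) : EReal) ≤ (φ x v : EReal) := by
    rw [← hb.limsup_eq]
    refine (limsup_le_limsup (Eventually.of_forall fun n => EReal.coe_le_coe_iff.2 ?_)).trans
      hlimsup
    have := h2 n
    simp only [map_sub] at this
    linarith [hmon n]
  have := EReal.coe_le_coe_iff.1 hle
  simp only [map_sub]
  linarith

lemma convexOn_dual_add_sub {K : Set V} (hK : Convex ℝ K) (f g : StrongDual ℝ V) {ψ : V → ℝ}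
    (hψ : ConvexOn ℝ K ψ) (u : V) : ConvexOn ℝ K fun v => f (v - u) + ψ v - g (v - u) := by
  have h1 : ConvexOn ℝ K fun v => (f - g) v + (g u - f u) :=
    ((f - g).toLinearMap.convexOn hK).add_const _
  refine (h1.add hψ).congr fun v _ => ?_
  simp only [Pi.add_apply, sub_apply, map_sub]
  ring

/-- Existence for bounded `K`. -/
theorem IsReflexive.exists_isSolution_of_isBounded [CompleteSpace V] (hV : IsReflexive V)
    {A : V →ₗ[ℝ] StrongDual ℝ V} (hA : ∀ v, 0 ≤ A v v) (g : StrongDual ℝ V) {K : Set V}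
    (hKc : IsClosed K) (hK : Convex ℝ K) (hKne : K.Nonempty) (hKb : Bornology.IsBounded K)
    {φ : V → V → ℝ} (hdiag : ∀ u ∈ K, φ u u = 0) (hconv : ∀ u ∈ K, ConvexOn ℝ K (φ u))
    (hpm : IsPseudomonotoneBifunction K φ) (husc : IsFiniteDimUSC K φ) :
    ∃ u, IsSolution A φ g K u := by
  have hAc := continuous_of_nonneg hA
  obtain ⟨u, huK, hu⟩ := hV.exists_equilibrium hKc hK hKne hKb
    (ψ := fun u v => A u (v - u) + φ u v - g (v - u))
    (fun u hu => by simp [hdiag u hu])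
    (fun u hu => convexOn_dual_add_sub hK (A u) g (hconv u hu) u)
    (fun v hv W hW => by
      have h1 : Continuous fun u => A u (v - u) - g (v - u) := by fun_prop
      have h2 := h1.continuousOn (s := K ∩ W) |>.upperSemicontinuousOn.add (husc v hv W hW)
      simpa only [sub_add_eq_add_sub] using h2)
    (fun s x hx v hv hs hsx h1 h2 => by
      have := nonneg_of_weaklyConverges hAc hA hpm g hs hx hv hsx
        (fun n => sub_nonneg.1 (h1 n)) fun n => sub_nonneg.1 (h2 n)
      linarith)
  exact ⟨u, huK, fun v hv => sub_nonneg.1 (hu v hv)⟩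

lemma IsPseudomonotoneBifunction.mono {K L : Set V} {φ : V → V → ℝ}
    (h : IsPseudomonotoneBifunction K φ) (hLK : L ⊆ K) : IsPseudomonotoneBifunction L φ :=
  fun u x hu hx hux h0 v hv => h u x (fun n => hLK (hu n)) (hLK hx) hux h0 v (hLK hv)

lemma IsFiniteDimUSC.mono {K L : Set V} {φ : V → V → ℝ}
    (h : IsFiniteDimUSC K φ) (hLK : L ⊆ K) : IsFiniteDimUSC L φ :=
  fun v hv W hW => (h v (hLK hv) W hW).mono (inter_subset_inter_left _ hLK)

/-- A solution of the problem truncated to a ball that lies inside the open ball solves the full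
problem, by convexity. -/
lemma IsSolution.of_truncated {A : V →ₗ[ℝ] StrongDual ℝ V} {g : StrongDual ℝ V} {K : Set V}
    {φ : V → V → ℝ} {u : V} {R : ℝ} (hK : Convex ℝ K) (hdiag : φ u u = 0)
    (hconv : ConvexOn ℝ K (φ u)) (hu : IsSolution A φ g (K ∩ Metric.closedBall 0 R) u)
    (huR : ‖u‖ < R) : IsSolution A φ g K u := by
  refine ⟨hu.1.1, fun v hv => ?_⟩
  have hcont : Tendsto (fun t : ℝ => ‖(1 - t) • u + t • v‖) (𝓝[>] 0) (𝓝 ‖u‖) := by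
    have h : Continuous fun t : ℝ => ‖(1 - t) • u + t • v‖ := by fun_prop
    simpa using (h.tendsto 0).mono_left nhdsWithin_le_nhds
  obtain ⟨t, htR, ht0, ht1⟩ := ((hcont.eventually_lt_const huR).and
    (Ioc_mem_nhdsGT zero_lt_one)).exists
  have hz : (1 - t) • u + t • v ∈ K := hK hu.1.1 hv (by linarith) ht0.le (by ring)
  have h1 := hu.2 _ ⟨hz, by simpa using htR.le⟩
  have h2 := (convexOn_dual_add_sub hK (A u) g hconv u).2 hu.1.1 hv (sub_nonneg.2 ht1) ht0.le
    (sub_add_cancel 1 t)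
  simp only [sub_self, map_zero, hdiag, add_zero, smul_eq_mul, mul_zero, zero_add] at h2
  have h3 : 0 ≤ t * (A u (v - u) + φ u v - g (v - u)) := by linarith
  linarith [nonneg_of_mul_nonneg_right h3 ht0]

/-- Solutions `u n` of truncated problems with `‖u n‖ → ∞` produce a unit vector `w` in the kernel
of `p` that spans a half-line in `K` and satisfies `g w ≥ -c`: a norm limit of a subsequence of the
normalized solutions. -/
lemma exists_recession_direction (hV : IsReflexive V) {p : Seminorm ℝ V}
    (hp : LowerSemicontinuous fun v => p v) {A : V →ₗ[ℝ] StrongDual ℝ V} {c₀ : ℝ} (hc₀ : 0 < c₀)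
    (hA : ∀ v, c₀ * p v ^ 2 ≤ A v v) (g : StrongDual ℝ V) {K : Set V} (hKc : IsClosed K)
    (hK : Convex ℝ K) (hK0 : (0 : V) ∈ K) {c : ℝ} (hcomp : SeminormCompactness p) {u : ℕ → V}
    (hu : ∀ n, u n ∈ K) (hun : Tendsto (fun n => ‖u n‖) atTop atTop) (hu0 : ∀ n, 0 < ‖u n‖)
    (hest : ∀ n, A (u n) (u n) ≤ c * ‖u n‖ + g (u n)) :
    ∃ w : V, ‖w‖ = 1 ∧ p w = 0 ∧ (∀ t : ℝ, 0 ≤ t → t • w ∈ K) ∧ -c ≤ g w := by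
  set w : ℕ → V := fun n => ‖u n‖⁻¹ • u n with hw
  have hw1 : ∀ n, ‖w n‖ = 1 := fun n => by
    rw [hw, norm_smul, norm_inv, norm_norm, inv_mul_cancel₀ (hu0 n).ne']
  have hpw : ∀ n, c₀ * p (w n) ^ 2 ≤ (c + g (w n)) * ‖u n‖⁻¹ := by
    intro n
    calc c₀ * p (w n) ^ 2 = ‖u n‖⁻¹ ^ 2 * (c₀ * p (u n) ^ 2) := by
          simp only [hw, map_smul_eq_mul, norm_inv, norm_norm]; ring
      _ ≤ ‖u n‖⁻¹ ^ 2 * (c * ‖u n‖ + g (u n)) := by gcongr; exact (hA _).trans (hest n)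
      _ = (c + g (w n)) * ‖u n‖⁻¹ := by
          have := (hu0 n).ne'
          simp only [hw, map_smul, smul_eq_mul]
          field_simp
  have hp0 : Tendsto (fun n => p (w n)) atTop (𝓝 0) := by
    have hsq : Tendsto (fun n => p (w n) ^ 2) atTop (𝓝 0) := by
      have hlim : Tendsto (fun n => (c + ‖g‖) / c₀ * ‖u n‖⁻¹) atTop (𝓝 0) := by
        simpa using (tendsto_inv_atTop_zero.comp hun).const_mul ((c + ‖g‖) / c₀)
      refine squeeze_zero (fun n => sq_nonneg _) (fun n => ?_) hlim
      rw [div_mul_eq_mul_div, le_div_iff₀' hc₀]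
      refine (hpw n).trans ?_
      gcongr
      simpa [hw1 n] using (le_abs_self _).trans (g.le_opNorm (w n))
    have := hsq.sqrt
    simpa [Real.sqrt_sq (apply_nonneg p _)] using this
  obtain ⟨x, k, hk, hkx⟩ := hV.exists_subseq_weaklyConverges (s := w)
    (isBounded_iff_forall_norm_le.2 ⟨1, by rintro _ ⟨n, rfl⟩; exact (hw1 n).le⟩)
  obtain ⟨k', hk', hlim⟩ := hcomp (w ∘ k) x (hp0.comp hk.tendsto_atTop) hkx
    ⟨1, one_pos, fun n => (hw1 _).ge⟩
  have hm : Tendsto (fun n => k (k' n)) atTop atTop := hk.tendsto_atTop.comp hk'.tendsto_atTop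
  refine ⟨x, ?_, ?_, fun t ht => ?_, ?_⟩
  · exact tendsto_nhds_unique hlim.norm (by simp [hw1])
  · refine le_antisymm ?_ (apply_nonneg p x)
    by_contra! hpos
    have h1 := hlim.eventually (hp x (p x / 2) (by linarith))
    have h2 := (hp0.comp hm).eventually_lt_const (half_pos hpos)
    obtain ⟨n, hn1, hn2⟩ := (h1.and h2).exists
    exact lt_asymm hn1 hn2
  · refine hKc.mem_of_tendsto (hlim.const_smul t) ?_
    filter_upwards [(hun.comp hm).eventually_ge_atTop t] with n hn
    have : t • w (k (k' n)) = (t * ‖u (k (k' n))‖⁻¹) • u (k (k' n)) := by rw [mul_smul]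
    change t • w (k (k' n)) ∈ K
    rw [this]
    refine hK.smul_mem_of_zero_mem hK0 (hu _) ⟨by positivity, ?_⟩
    rw [← div_eq_mul_inv]
    exact div_le_one_of_le₀ hn (norm_nonneg _)
  · refine ge_of_tendsto' ((g.continuous.tendsto x).comp hlim) fun n => ?_
    have h1 : 0 ≤ (c + g (w (k (k' n)))) * ‖u (k (k' n))‖⁻¹ :=
      le_trans (by positivity) (hpw _)
    have h2 := nonneg_of_mul_nonneg_left h1 (inv_pos.2 (hu0 _))
    change -c ≤ g (w (k (k' n)))
    linarith

end Existence

end SemicoerciveVI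

theorem theorem1 {V : Type*} [NormedAddCommGroup V] [NormedSpace ℝ V] [CompleteSpace V]
    (hV : SemicoerciveVI.IsReflexive V)
    (p : Seminorm ℝ V) (A : V →ₗ[ℝ] StrongDual ℝ V) (hA : SemicoerciveVI.IsSemicoercive A p)
    (g : StrongDual ℝ V)
    (K : Set V) (hKclosed : IsClosed K) (hKconvex : Convex ℝ K) (hK0 : (0 : V) ∈ K)
    (φ : V → V → ℝ)
    (hφdiag : ∀ u ∈ K, φ u u = 0) (hφconvex : ∀ u ∈ K, ConvexOn ℝ K (φ u))
    (hφpm : SemicoerciveVI.IsPseudomonotoneBifunction K φ)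
    (hφusc : SemicoerciveVI.IsFiniteDimUSC K φ)
    (c : ℝ) (hc : 0 < c) (hφgrowth : ∀ v ∈ K, φ v 0 ≤ c * ‖v‖)
    (hA1 : SemicoerciveVI.SeminormCompactness p)
    (hA2 : Bornology.IsBounded (SemicoerciveVI.seminormKernel p ∩ K) ∨
      ∀ y ∈ SemicoerciveVI.seminormKernel p ∩ K, ‖y‖ = 1 → g y < -c) :
    ∃ u : V, SemicoerciveVI.IsSolution A φ g K u := by
  obtain ⟨hp, c₀, hc₀, hA⟩ := hA
  have hA0 : ∀ v, 0 ≤ A v v := fun v => le_trans (by positivity) (hA v)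
  by_contra! hno
  have hR : ∀ n : ℕ, ∃ u : V,
      SemicoerciveVI.IsSolution A φ g (K ∩ Metric.closedBall 0 ((n : ℝ) + 1)) u := by
    intro n
    have hsub : K ∩ Metric.closedBall 0 ((n : ℝ) + 1) ⊆ K := Set.inter_subset_left
    have hconv := hKconvex.inter (convex_closedBall (0 : V) ((n : ℝ) + 1))
    exact hV.exists_isSolution_of_isBounded hA0 g (hKclosed.inter Metric.isClosed_closedBall) hconv
      ⟨0, hK0, Metric.mem_closedBall_self (by positivity)⟩
      (Metric.isBounded_closedBall.subset Set.inter_subset_right)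
      (fun u hu => hφdiag u hu.1) (fun u hu => (hφconvex u hu.1).subset hsub hconv)
      (hφpm.mono hsub) (hφusc.mono hsub)
  -- Without a solution of the full problem, `u n` must lie on the sphere bounding its ball.
  choose u hu using hR
  have huK : ∀ n, u n ∈ K := fun n => (hu n).1.1
  have hnorm : ∀ n, ‖u n‖ = (n : ℝ) + 1 := fun n => by
    refine le_antisymm (by simpa using (hu n).1.2) (not_lt.1 fun h => ?_)
    exact hno (u n) ((hu n).of_truncated hKconvex (hφdiag _ (huK n)) (hφconvex _ (huK n)) h)
  obtain ⟨w, hw1, hpw, hwK, hgw⟩ := SemicoerciveVI.exists_recession_direction (c := c) hV hp hc₀ hA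
    g hKclosed hKconvex hK0 hA1 huK
    (by simpa only [hnorm] using tendsto_atTop_add_const_right _ 1 tendsto_natCast_atTop_atTop)
    (fun n => by rw [hnorm]; positivity) fun n => by
      have h1 := (hu n).2 0 ⟨hK0, Metric.mem_closedBall_self (by positivity)⟩
      have h2 := hφgrowth (u n) (huK n)
      simp only [zero_sub, map_neg] at h1
      linarith
  rcases hA2 with hb | hlt
  · obtain ⟨C, hC⟩ := hb.exists_norm_le
    have hC0 : 0 ≤ C := (norm_nonneg _).trans (hC 0 ⟨map_zero p, hK0⟩)
    have h1 := hC ((C + 1) • w)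
      ⟨show p ((C + 1) • w) = 0 by rw [map_smul_eq_mul, hpw, mul_zero], hwK _ (by linarith)⟩
    rw [norm_smul, hw1, Real.norm_of_nonneg (by linarith)] at h1
    linarith
  · have h1 := hlt w ⟨hpw, by simpa using hwK 1 zero_le_one⟩ hw1
    linarith
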